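/- For a Young diagram $\mu$ with $N$ cells let $d_\mu$ be the number of standard Young tableaux of shape $\mu$, and let $l^{(k)}(\mu)$ be the number of cells in the $k$-th row of $\mu$. For $k\ge 1$ and $n,N\ge 0$ put $$q^{(k)}_{n,N}=\frac1{N!}\sum_{\mu\vdash N,\ l^{(k)}(\mu)\le n} d_\mu^2 ,\qquad \phi^{(k)}_n(\lambda)=\sum_{N=0}^\infty \frac{e^{-\lambda}\lambda^N}{N!}\,q^{(k)}_{n,N}$$ (so $q^{(k)}_{n,0}=1$). Let $\lambda\ge 0$. For $n\ge 1$ let $$T_{n-1}=\Bigl(\int_0^{2\pi}e^{-i(j-k)\theta}e^{2\sqrt\lambda\cos\theta}\,\frac{d\theta}{2\pi}\Bigr)_{0\le j,k\le n-1},$$ and define $$a_0(0)=\sum_{m=0}^\infty\frac{\lambda^m}{(m!)^2},\qquad a_0(s)=\sum_{m=1}^\infty\frac{\lambda^m}{(m+s)^2((m-1)!)^2}\quad(s\ge1),$$ $$a_j(s)=\sum_{m=j}^\infty\frac{\lambda^{m-j/2}}{(m+s)\,(m-1)!\,(m-j)!}\quad(j\ge1,\ s\ge0),\qquad b_n(s)=(a_1(s),\dots,a_n(s))^T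 .$$ Then the series defining $\phi^{(1)}_n(\lambda)$ and $\phi^{(2)}_{n+1}(\lambda)$ converge for every $n\ge 0$; for every $n\ge 1$ the matrix $T_{n-1}$ is invertible and $$\phi^{(2)}_{n+1}(\lambda)=\Bigl[\sum_{s=0}^\infty\frac{\lambda^s}{(s!)^2}\Bigl(a_0(s)-\bigl(T_{n-1}^{-1}b_n(s),b_n(s)\bigr)\Bigr)\Bigr]\phi^{(1)}_n(\lambda),$$ where $(\cdot,\cdot)$ is the standard inner product and the series over $s$ converges absolutely; and for $n=0$ $$\phi^{(2)}_{1}(\lambda)=\Bigl[\sum_{s=0}^\infty\frac{\lambda^s}{(s!)^2}\,a_0(s)\Bigr]\phi^{(1)}_0(\lambda),$$ again with an absolutely convergent series. -/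

import Mathlib

namespace PlancherelSecondRow

open scoped Nat

/-- A standard Young tableau of shape `μ`: a bijective filling of the `N = μ.card` cells by
`N` labels (here `0, …, N - 1`) that increases strictly along every row (left to right) and
down every column. The cell `(i, j)` lies in row `i` and column `j`. -/
def StandardYoungTableau (μ : YoungDiagram) : Type :=
  {T : μ.cells ≃ Fin μ.card //
    (∀ c c' : μ.cells, c.1.1 = c'.1.1 → c.1.2 < c'.1.2 → T c < T c') ∧
    (∀ c c' : μ.cells, c.1.2 = c'.1.2 → c.1.1 < c'.1.1 → T c < T c')}

/-- `d_μ`, the number of standard Young tableaux of shape `μ`. -/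
noncomputable def numSYT (μ : YoungDiagram) : ℕ := Nat.card (StandardYoungTableau μ)

theorem finite_setOf_card_eq (N : ℕ) : {μ : YoungDiagram | μ.card = N}.Finite := by
  have hinj : Function.Injective YoungDiagram.cells := fun _ _ h => YoungDiagram.ext h
  refine Set.Finite.of_finite_image (f := YoungDiagram.cells) ?_ hinj.injOn
  refine (((Finset.range N ×ˢ Finset.range N).powerset).finite_toSet).subset ?_
  rintro _ ⟨μ, rfl, rfl⟩
  simp only [Finset.coe_powerset, Set.mem_preimage, Set.mem_powerset_iff, Finset.coe_subset]
  rintro ⟨i, j⟩ hc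
  have hc' : (i, j) ∈ μ := hc
  rw [Finset.mem_product, Finset.mem_range, Finset.mem_range]
  constructor
  · refine (YoungDiagram.mem_iff_lt_colLen.1 hc').trans_le ?_
    rw [YoungDiagram.colLen_eq_card]
    exact Finset.card_le_card (Finset.filter_subset _ _)
  · refine (YoungDiagram.mem_iff_lt_rowLen.1 hc').trans_le ?_
    rw [YoungDiagram.rowLen_eq_card]
    exact Finset.card_le_card (Finset.filter_subset _ _)

/-- `Y_N`, the finite set of all Young diagrams with `N` cells. -/
noncomputable def youngDiagrams (N : ℕ) : Finset YoungDiagram := (finite_setOf_card_eq N).toFinset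

/-- `q^{(k)}_{n,N}` for `k ≥ 1`: the probability, under Plancherel measure `μ ↦ d_μ² / N!`
on `Y_N`, that the `k`-th row has at most `n` cells. Mathlib numbers the rows from `0`. For `N = 0`
the only diagram is the empty one and the value is `1` (see `q_zero`). -/
noncomputable def q (k n N : ℕ) : ℝ :=
  ∑ μ ∈ youngDiagrams N with μ.rowLen (k - 1) ≤ n, (numSYT μ : ℝ) ^ 2 / (N ! : ℝ)

theorem q_zero (k n : ℕ) : q k n 0 = 1 := by
  have hY : youngDiagrams 0 = {⊥} := by
    ext μ
    simp only [youngDiagrams, Set.Finite.mem_toFinset, Set.mem_ofPred_eq, Finset.mem_singleton]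
    constructor
    · intro h
      exact YoungDiagram.ext (Finset.card_eq_zero.1 h)
    · rintro rfl
      rfl
  have hr : (⊥ : YoungDiagram).rowLen (k - 1) = 0 := by
    rw [YoungDiagram.rowLen_eq_card]; rfl
  have hd : numSYT ⊥ = 1 := by
    have hE : IsEmpty (⊥ : YoungDiagram).cells := ⟨fun c => absurd c.2 (Finset.notMem_empty _)⟩
    have hF : IsEmpty (Fin (⊥ : YoungDiagram).card) := ⟨fun c => absurd c.2 (Nat.not_lt_zero _)⟩
    rw [numSYT, Nat.card_eq_one_iff_unique]
    refine ⟨⟨fun a b => Subtype.ext (Equiv.ext fun c => hE.elim c)⟩, ⟨⟨Equiv.equivOfIsEmpty _ _, ?_⟩⟩⟩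
    exact ⟨fun c => hE.elim c, fun c => hE.elim c⟩
  simp [q, hY, hd, hr, Finset.filter_singleton]

/-- The `N`-th term of the Poissonization of `q^{(k)}_{n,N}`. -/
noncomputable def phiTerm (k n : ℕ) (lam : ℝ) (N : ℕ) : ℝ :=
  Real.exp (-lam) * lam ^ N / (N ! : ℝ) * q k n N

/-- `φ^{(k)}_n(λ) = ∑_N e^{-λ} λ^N / N! q^{(k)}_{n,N}`. -/
noncomputable def phi (k n : ℕ) (lam : ℝ) : ℝ := ∑' N : ℕ, phiTerm k n lam N

/-- The `n × n` Toeplitz matrix `T_{n-1}` of the weight `e^{2√λ cos θ} dθ / 2π`. -/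
noncomputable def toeplitz (lam : ℝ) (n : ℕ) : Matrix (Fin n) (Fin n) ℂ :=
  Matrix.of fun j k => ∫ θ in (0 : ℝ)..2 * Real.pi,
    Complex.exp (-Complex.I * ((j : ℂ) - (k : ℂ)) * θ) *
      (Real.exp (2 * √lam * Real.cos θ) : ℂ) / (2 * Real.pi)

/-- `a_0(s)`; in the series for `s ≥ 1` the summation index `m ≥ 1` is written `m = i + 1`. -/
noncomputable def aZero (lam : ℝ) (s : ℕ) : ℝ :=
  if s = 0 then ∑' m : ℕ, lam ^ m / (m ! : ℝ) ^ 2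
  else ∑' i : ℕ, lam ^ (i + 1) / (((i : ℝ) + 1 + s) ^ 2 * (i ! : ℝ) ^ 2)

/-- `a_j(s) = ∑_{m ≥ j} λ^{m - j/2} / ((m + s) (m - 1)! (m - j)!)` for `j ≥ 1`; the summation
index is written `m = i + j`. -/
noncomputable def a (lam : ℝ) (j s : ℕ) : ℝ :=
  ∑' i : ℕ, lam ^ ((i : ℝ) + (j : ℝ) / 2) /
    (((i : ℝ) + j + s) * ((i + j - 1)! : ℝ) * (i ! : ℝ))

/-- `b_n(s) = (a_1(s), …, a_n(s))ᵀ`. -/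
noncomputable def b (lam : ℝ) (n s : ℕ) : Fin n → ℂ := fun j => (a lam ((j : ℕ) + 1) s : ℂ)

/-- `λ^s / (s!)² (a_0(s) - (T_{n-1}⁻¹ b_n(s), b_n(s)))`. -/
noncomputable def bracketTerm (lam : ℝ) (n s : ℕ) : ℂ :=
  (lam : ℂ) ^ s / (s ! : ℂ) ^ 2 *
    ((aZero lam s : ℂ) - ((toeplitz lam n)⁻¹.mulVec (b lam n s)) ⬝ᵥ star (b lam n s))

/-!
Read a diagram whose second row has at most `L` cells as an arm of `s` cells sticking out of the
first row beyond column `L`, together with the positions of `L` beads `μ.colLen (L - 1 - i) + i`.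
Removing a corner moves one bead down or shortens the arm, and the recursion for `d_μ` under corner
removal is satisfied by `x ^ s / s!` times an `L × L` determinant in the bead positions. By the
infinite Cauchy–Binet identity, the sum of the squares of these determinants over all strictly
increasing bead positions is the determinant of a Gram matrix `G_s`. Hence, with `x = √λ`,
`φ⁽¹⁾_n = e^{-λ} det G_0` with `G_0` of size `n`, and
`φ⁽²⁾_{n+1} = e^{-λ} ∑_s λ^s / (s!)² det G_s` with `G_s` of size `n + 1`. The arm enters only the
first row and column of `G_s`; what remains is the `n × n` matrix `G_0`, which Fourier expansion
identifies with `T_{n-1}`. The bracket of the theorem is the Schur complement of that block.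
-/

section Determinants

open Matrix

variable {n R : Type*} [Fintype n] [DecidableEq n] [CommRing R]

theorem sum_det_updateRow (D E : Matrix n n R) :
    ∑ i, (D.updateRow i (E i)).det = (E * D.adjugate).trace := by
  refine Finset.sum_congr rfl fun i _ => ?_
  rw [← cramer_transpose_apply, cramer_eq_adjugate_mulVec, ← adjugate_transpose, mulVec_transpose,
    diag_apply, mul_apply]
  rfl

theorem trace_mul_mul_adjugate (C D : Matrix n n R) :
    (C * D * D.adjugate).trace = C.trace * D.det := by
  rw [Matrix.mul_assoc, mul_adjugate, Matrix.mul_smul, Matrix.mul_one, trace_smul, smul_eq_mul,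
    mul_comm]

theorem trace_mul_mul_adjugate' (C D : Matrix n n R) :
    (D * C * D.adjugate).trace = C.trace * D.det := by
  rw [trace_mul_comm, ← Matrix.mul_assoc, adjugate_mul, smul_mul, Matrix.one_mul, trace_smul,
    smul_eq_mul, mul_comm]

theorem trace_vecMulVec_single_mul_adjugate (D : Matrix n n R) (v : n → R) (j : n) :
    (vecMulVec v (Pi.single j 1) * D.adjugate).trace = (D.updateCol j v).det := by
  rw [vecMulVec_mul, trace_vecMulVec, ← cramer_apply, cramer_eq_adjugate_mulVec, single_one_vecMul,
    dotProduct_comm]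
  rfl

theorem det_eq_det_mul_schurComplement {k : ℕ} (M : Matrix (Fin (k + 1)) (Fin (k + 1)) R)
    {D : Matrix (Fin k) (Fin k) R} (hM : M.submatrix Fin.succ Fin.succ = D) (hD : IsUnit D.det) :
    M.det = D.det * (M 0 0 - (D⁻¹ *ᵥ fun i => M i.succ 0) ⬝ᵥ fun j => M 0 j.succ) := by
  let e : Fin (k + 1) ≃ Fin k ⊕ Unit := (finSuccEquiv k).trans (Equiv.optionEquivSumPUnit (Fin k))
  have := D.invertibleOfIsUnitDet hD
  have hblocks : M.submatrix e.symm e.symm = fromBlocks D (of fun i _ => M i.succ 0)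
      (of fun _ j => M 0 j.succ) (of fun _ _ => M 0 0) := by
    ext (i | i) (j | j) <;> simp [e, ← hM]
  rw [← det_submatrix_equiv_self e.symm M, hblocks, det_fromBlocks₁₁, det_unique (n := Unit),
    Matrix.mul_assoc, invOf_eq_nonsing_inv, dotProduct_comm]
  rfl

end Determinants

section CauchyBinet

open Matrix Filter

variable {L : ℕ} {ι : Type*} {R : Type*} [CommRing R]

theorem det_comp_perm (g : Fin L → ι → R) (h : Fin L → ι) (σ : Equiv.Perm (Fin L)) :
    (of fun i j => g j ((h ∘ σ) i)).det = Equiv.Perm.sign σ * (of fun i j => g j (h i)).det :=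
  det_permute σ (of fun i j => g j (h i))

theorem det_of_sum_mul_eq_sum_prod_mul_det (f g : Fin L → ι → R) (s : Finset ι) :
    (of fun j k => ∑ m ∈ s, f j m * g k m).det =
      ∑ h ∈ Fintype.piFinset (fun _ : Fin L => s),
        (∏ i, f i (h i)) * (of fun i j => g j (h i)).det := by
  have hdet (h : Fin L → ι) : (of fun i j => g j (h i)).det =
      ∑ σ : Equiv.Perm (Fin L), Equiv.Perm.sign σ * ∏ i, g (σ i) (h i) := by
    rw [← det_transpose, det_apply']
    rfl
  simp_rw [hdet, Finset.mul_sum]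
  rw [← det_transpose, det_apply', Finset.sum_comm]
  refine Finset.sum_congr rfl fun σ _ => ?_
  simp only [transpose_apply, of_apply, Finset.prod_univ_sum, Finset.mul_sum,
    Finset.prod_mul_distrib, mul_left_comm]

variable [LinearOrder ι]

theorem existsUnique_strictMono_comp_perm {h : Fin L → ι} (hh : Function.Injective h) :
    ∃! σ : Equiv.Perm (Fin L), StrictMono (h ∘ σ) := by
  refine ⟨Tuple.sort h, (Tuple.monotone_sort h).strictMono_of_injective
    (hh.comp (Tuple.sort h).injective), fun τ hτ => ?_⟩
  exact Equiv.ext fun i =>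
    hh (congrFun (Tuple.unique_monotone hτ.monotone (Tuple.monotone_sort h)) i)

theorem sum_piFinset_eq_sum_strictMono {A : Type*} [AddCommMonoid A] {F : (Fin L → ι) → A}
    (hF : ∀ h, ¬ Function.Injective h → F h = 0) (s : Finset ι) :
    ∑ h ∈ Fintype.piFinset (fun _ : Fin L => s), F h =
      ∑ h ∈ Fintype.piFinset (fun _ : Fin L => s),
        if StrictMono h then ∑ σ : Equiv.Perm (Fin L), F (h ∘ σ) else 0 := by
  have hsplit (h : Fin L → ι) :
      F h = ∑ σ : Equiv.Perm (Fin L), if StrictMono (h ∘ σ) then F h else 0 := by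
    by_cases hh : Function.Injective h
    · obtain ⟨σ, hσ, huniq⟩ := existsUnique_strictMono_comp_perm hh
      rw [Finset.sum_eq_single σ (fun τ _ hτ => if_neg fun hmono => hτ (huniq τ hmono)) (by simp),
        if_pos hσ]
    · simp [hF h hh]
  have hperm (σ : Equiv.Perm (Fin L)) :
      ∑ h ∈ Fintype.piFinset (fun _ : Fin L => s), (if StrictMono (h ∘ σ) then F h else 0) =
        ∑ h ∈ Fintype.piFinset (fun _ : Fin L => s),
          if StrictMono h then F (h ∘ σ.symm) else 0 := by
    refine Finset.sum_equiv (σ.symm.arrowCongr (Equiv.refl ι)) (fun h => ?_) fun h _ => ?_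
    · simpa using (σ.forall_congr_right (q := fun i => h i ∈ s)).symm
    · have hcomp : σ.symm.arrowCongr (Equiv.refl ι) h = h ∘ σ := rfl
      rw [hcomp, Function.comp_assoc, Equiv.self_comp_symm, Function.comp_id]
  rw [Finset.sum_congr rfl fun h _ => hsplit h, Finset.sum_comm,
    Finset.sum_congr rfl fun σ _ => hperm σ, Finset.sum_comm]
  refine Finset.sum_congr rfl fun h _ => ?_
  split_ifs
  · exact Equiv.sum_comp (Equiv.inv (Equiv.Perm (Fin L))) fun σ => F (h ∘ σ)
  · exact Finset.sum_const_zero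

theorem det_of_sum_mul_eq_sum_strictMono (f g : Fin L → ι → R) (s : Finset ι) :
    (of fun j k => ∑ m ∈ s, f j m * g k m).det =
      ∑ h ∈ Fintype.piFinset (fun _ : Fin L => s), if StrictMono h then
        (of fun i j => f j (h i)).det * (of fun i j => g j (h i)).det else 0 := by
  rw [det_of_sum_mul_eq_sum_prod_mul_det, sum_piFinset_eq_sum_strictMono]
  · refine Finset.sum_congr rfl fun h _ => if_congr Iff.rfl ?_ rfl
    simp_rw [det_comp_perm, ← mul_assoc, ← Finset.sum_mul, det_apply', mul_comm (∏ _, _)]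
    rfl
  · intro h hh
    obtain ⟨i, j, hij, hne⟩ := Function.not_injective_iff.1 hh
    rw [det_zero_of_row_eq hne (by ext k; simp [hij]), mul_zero]

theorem hasSum_of_tendsto_sum_of_nonneg {κ α : Type*} [SemilatticeSup κ] [Nonempty κ]
    {F : α → ℝ} {a : ℝ} (hF : ∀ i, 0 ≤ F i) {A : κ → Finset α} (hA : Monotone A)
    (hcover : ∀ i, ∃ k, i ∈ A k) (hlim : Tendsto (fun k => ∑ i ∈ A k, F i) atTop (nhds a)) :
    HasSum F a :=
  (tendsto_iff_tendsto_subseq_of_monotone (Finset.sum_mono_set_of_nonneg hF)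
    (tendsto_atTop_finset_of_monotone hA hcover)).2 hlim

-- Andréief's identity: let the finite set of summation indices grow in the Cauchy–Binet formula.
theorem hasSum_strictMono_det_sq (f : Fin L → ι → ℝ)
    (hf : ∀ j k, Summable fun m => f j m * f k m) :
    HasSum (fun h : Fin L → ι => if StrictMono h then (of fun i j => f j (h i)).det ^ 2 else 0)
      (of fun j k => ∑' m, f j m * f k m).det := by
  refine hasSum_of_tendsto_sum_of_nonneg (fun h => by positivity)
    (A := fun s : Finset ι => Fintype.piFinset fun _ : Fin L => s)
    (fun s t hst => Fintype.piFinset_subset _ _ fun _ => hst)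
    (fun h => ⟨Finset.univ.image h, by simp⟩) ?_
  simp only [sq, ← det_of_sum_mul_eq_sum_strictMono]
  have hdet : Continuous fun M : Matrix (Fin L) (Fin L) ℝ => M.det := continuous_id.matrix_det
  exact (hdet.tendsto _).comp
    (tendsto_pi_nhds.2 fun j => tendsto_pi_nhds.2 fun k => (hf j k).hasSum)

end CauchyBinet

section NaturalLabelling

/-- The natural labellings (linear extensions) of the order induced on `S`: its bijections with
`Fin N` that are strictly increasing. For the cells of a Young diagram these are the standard
tableaux. -/
def NaturalLabelling {α : Type*} [Preorder α] (S : Finset α) (N : ℕ) : Type _ :=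
  {T : S ≃ Fin N // StrictMono T}

namespace NaturalLabelling

variable {α : Type*} [Preorder α] {S : Finset α} {N : ℕ}

instance : Finite (NaturalLabelling S N) := inferInstanceAs (Finite (Subtype _))

theorem card_of_isEmpty [IsEmpty S] : Nat.card (NaturalLabelling S 0) = 1 :=
  Nat.card_eq_one_iff_unique.2 ⟨⟨fun _ _ => Subtype.ext (Equiv.ext fun c => isEmptyElim c)⟩,
    ⟨Equiv.equivOfIsEmpty _ _, fun c => isEmptyElim c⟩⟩

theorem maximal_of_apply_eq_last (T : NaturalLabelling S (N + 1)) {x : S}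
    (hx : T.1 x = Fin.last N) : Maximal (· ∈ S) x.1 := by
  refine ⟨x.2, fun y hy hxy => ?_⟩
  by_contra hyx
  have hlt : T.1 x < T.1 ⟨y, hy⟩ := T.2 (lt_of_le_not_ge hxy hyx)
  exact (Fin.le_last _).not_gt (hx ▸ hlt)

variable [DecidableEq α]

/-- Forget the cell carrying the largest label. -/
def dropLast (T : NaturalLabelling S (N + 1)) (x : S) (hx : T.1 x = Fin.last N) :
    NaturalLabelling (S.erase x) N where
  val :=
    { toFun y := (T.1 ⟨y, Finset.mem_of_mem_erase y.2⟩).castPred fun hy =>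
        Finset.ne_of_mem_erase y.2 (congrArg Subtype.val (T.1.injective (hy.trans hx.symm)))
      invFun k := ⟨T.1.symm k.castSucc, Finset.mem_erase.2 ⟨fun hk =>
        k.castSucc_lt_last.ne (((T.1.symm_apply_eq).1 (Subtype.ext hk)).trans hx),
        Subtype.property _⟩⟩
      left_inv y := by simp
      right_inv k := by simp }
  property _ _ hyz := T.2 hyz

/-- Give the largest label to the maximal cell `x`, on top of a labelling of the other cells. -/
def addLast {x : α} (hx : Maximal (· ∈ S) x) (T : NaturalLabelling (S.erase x) N) :
    NaturalLabelling S (N + 1) where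
  val :=
    { toFun y := if hy : y = x then Fin.last N else (T.1 ⟨y, Finset.mem_erase.2 ⟨hy, y.2⟩⟩).castSucc
      invFun k := Fin.lastCases ⟨x, hx.prop⟩
        (fun k => ⟨T.1.symm k, Finset.mem_of_mem_erase (T.1.symm k).2⟩) k
      left_inv y := by
        by_cases hy : y = x
        · simp [hy, Subtype.ext_iff]
        · simp [hy]
      right_inv k := by
        induction k using Fin.lastCases with
        | last => simp
        | cast k => simp [Finset.ne_of_mem_erase (T.1.symm k).2] }
  property y z hyz := by
    have hyx : (y : α) ≠ x := fun h => hx.not_gt z.2 (h ▸ hyz)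
    by_cases hzx : (z : α) = x
    · simp [hyx, hzx, Fin.castSucc_lt_last]
    · simpa [hyx, hzx] using T.2 hyz

/-- Labellings with the largest label at `x` are labellings of the other cells. -/
def fiberEquiv {x : α} (hx : Maximal (· ∈ S) x) :
    {T : NaturalLabelling S (N + 1) // T.1 ⟨x, hx.prop⟩ = Fin.last N} ≃
      NaturalLabelling (S.erase x) N where
  toFun T := T.1.dropLast ⟨x, hx.prop⟩ T.2
  invFun T := ⟨addLast hx T, by simp [addLast]⟩
  left_inv := by
    rintro ⟨T, hT⟩
    refine Subtype.ext (Subtype.ext (Equiv.ext fun y => ?_))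
    by_cases hy : y = ⟨x, hx.prop⟩
    · simp [addLast, hy, hT]
    · simp [addLast, dropLast, Subtype.ext_iff.not.1 hy]
  right_inv T := by
    refine Subtype.ext (Equiv.ext fun y => ?_)
    simp [addLast, dropLast, Finset.ne_of_mem_erase y.2]

open scoped Classical in
theorem card_succ (S : Finset α) (N : ℕ) : Nat.card (NaturalLabelling S (N + 1)) =
    ∑ x ∈ S with Maximal (· ∈ S) x, Nat.card (NaturalLabelling (S.erase x) N) := by
  have hfiber (x : S) : Nat.card {T : NaturalLabelling S (N + 1) // T.1.symm (Fin.last N) = x} =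
      if Maximal (· ∈ S) x.1 then Nat.card (NaturalLabelling (S.erase x) N) else 0 := by
    simp_rw [Equiv.symm_apply_eq, eq_comm (a := Fin.last N)]
    split_ifs with hx
    · exact Nat.card_congr (fiberEquiv hx)
    · have : IsEmpty {T : NaturalLabelling S (N + 1) // T.1 x = Fin.last N} :=
        ⟨fun T => hx (T.1.maximal_of_apply_eq_last T.2)⟩
      exact Nat.card_of_isEmpty
  rw [← Nat.card_congr (Equiv.sigmaFiberEquiv fun T : NaturalLabelling S (N + 1) =>
    T.1.symm (Fin.last N)), Nat.card_sigma, Finset.sum_congr rfl fun x _ => hfiber x,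
    Finset.sum_coe_sort S fun x =>
      if Maximal (· ∈ S) x then Nat.card (NaturalLabelling (S.erase x) N) else 0, Finset.sum_filter]

end NaturalLabelling

theorem strictMono_iff_row_col {μ : YoungDiagram} {β : Type*} [Preorder β] (T : μ.cells → β) :
    StrictMono T ↔ (∀ c c' : μ.cells, c.1.1 = c'.1.1 → c.1.2 < c'.1.2 → T c < T c') ∧
      ∀ c c' : μ.cells, c.1.2 = c'.1.2 → c.1.1 < c'.1.1 → T c < T c' := by
  constructor
  · exact fun hT => ⟨fun c c' hrow hcol => hT (Prod.lt_of_le_of_lt hrow.le hcol),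
      fun c c' hcol hrow => hT (Prod.lt_of_lt_of_le hrow hcol.le)⟩
  · rintro ⟨hrow, hcol⟩ ⟨⟨i, j⟩, hc⟩ ⟨⟨i', j'⟩, hc'⟩ hlt
    obtain ⟨hi, hj⟩ : i ≤ i' ∧ j ≤ j' := hlt.le
    have hcorner : (i, j') ∈ μ.cells := μ.up_left_mem hi le_rfl hc'
    rcases hi.eq_or_lt with rfl | hi'
    · exact hrow ⟨_, hc⟩ ⟨_, hc'⟩ rfl (by simpa using hlt)
    rcases hj.eq_or_lt with rfl | hj'
    · exact hcol ⟨_, hc⟩ ⟨_, hc'⟩ rfl hi'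
    exact (hrow ⟨_, hc⟩ ⟨_, hcorner⟩ rfl hj').trans (hcol ⟨_, hcorner⟩ ⟨_, hc'⟩ rfl hi')

theorem numSYT_eq_card_naturalLabelling (μ : YoungDiagram) :
    numSYT μ = Nat.card (NaturalLabelling μ.cells μ.card) :=
  Nat.card_congr (Equiv.subtypeEquivRight fun T => (strictMono_iff_row_col T).symm)

end NaturalLabelling

section Corners

theorem lt_colLen_iff_lt_rowLen {μ : YoungDiagram} {i j : ℕ} : i < μ.colLen j ↔ j < μ.rowLen i := by
  rw [← YoungDiagram.mem_iff_lt_colLen, YoungDiagram.mem_iff_lt_rowLen]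

theorem youngDiagram_ext_colLen {μ ν : YoungDiagram} (h : ∀ j, μ.colLen j = ν.colLen j) :
    μ = ν := by
  refine YoungDiagram.ext (Finset.ext fun ⟨i, j⟩ => ?_)
  rw [YoungDiagram.mem_cells, YoungDiagram.mem_cells, YoungDiagram.mem_iff_lt_colLen, h,
    YoungDiagram.mem_iff_lt_colLen]

theorem card_eq_sum_colLen {μ : YoungDiagram} {K : ℕ} (hK : μ.rowLen 0 ≤ K) :
    μ.card = ∑ p ∈ Finset.range K, μ.colLen p := by
  have hmaps : ∀ c ∈ μ.cells, c.2 ∈ Finset.range K := fun c hc => Finset.mem_range.2 <|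
    (YoungDiagram.mem_iff_lt_rowLen.1 (μ.up_left_mem (Nat.zero_le c.1) le_rfl hc)).trans_le hK
  simp only [YoungDiagram.colLen_eq_card, YoungDiagram.col]
  exact Finset.card_eq_sum_card_fiberwise hmaps

/-- The diagram without the bottom cell of column `p`, when `p` is a corner column, that is, when
`μ.colLen (p + 1) < μ.colLen p`. All cells weakly below and to the right of that cell are removed,
so that the result is a diagram for every `p`. -/
def removeCorner (μ : YoungDiagram) (p : ℕ) : YoungDiagram where
  cells := {c ∈ μ.cells | ¬ (μ.colLen p - 1, p) ≤ c}
  isLowerSet c d hdc hc := by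
    simp only [Finset.coe_filter, Set.mem_ofPred_eq] at hc ⊢
    exact ⟨μ.isLowerSet hdc hc.1, fun hd => hc.2 (hd.trans hdc)⟩

variable {μ : YoungDiagram} {p : ℕ}

theorem maximal_mem_cells_iff {i p : ℕ} : Maximal (· ∈ μ.cells) (i, p) ↔
    i = μ.colLen p - 1 ∧ μ.colLen (p + 1) < μ.colLen p := by
  simp only [Maximal, YoungDiagram.mem_cells, YoungDiagram.mem_iff_lt_colLen, Prod.forall,
    Prod.mk_le_mk]
  constructor
  · rintro ⟨hi, hmax⟩
    have hbelow := hmax (i + 1) p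
    have hright := hmax i (p + 1)
    omega
  · rintro ⟨rfl, hp⟩
    refine ⟨by omega, fun i q hiq hle => ?_⟩
    have hqp : q ≤ p := by
      by_contra hpq
      have := μ.colLen_anti (p + 1) q (by omega)
      omega
    have := μ.colLen_anti p q hle.2
    obtain rfl : q = p := le_antisymm hqp hle.2
    omega

theorem cells_removeCorner (hp : μ.colLen (p + 1) < μ.colLen p) :
    (removeCorner μ p).cells = μ.cells.erase (μ.colLen p - 1, p) := by
  have hmax : Maximal (· ∈ μ.cells) (μ.colLen p - 1, p) := maximal_mem_cells_iff.2 ⟨rfl, hp⟩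
  ext c
  simp only [removeCorner, Finset.mem_filter, Finset.mem_erase, and_comm]
  exact and_congr_right fun hc =>
    ⟨fun hle heq => hle heq.ge, fun hne hle => hne (hmax.eq_of_ge hc hle)⟩

theorem card_removeCorner (hp : μ.colLen (p + 1) < μ.colLen p) :
    (removeCorner μ p).card + 1 = μ.card := by
  rw [YoungDiagram.card, cells_removeCorner hp]
  exact Finset.card_erase_add_one (maximal_mem_cells_iff.2 ⟨rfl, hp⟩).prop

theorem colLen_removeCorner (hp : μ.colLen (p + 1) < μ.colLen p) :
    (removeCorner μ p).colLen = Function.update μ.colLen p (μ.colLen p - 1) := by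
  ext q
  refine eq_of_forall_lt_iff fun i => ?_
  rw [← YoungDiagram.mem_iff_lt_colLen, ← YoungDiagram.mem_cells, cells_removeCorner hp,
    Finset.mem_erase, YoungDiagram.mem_cells, YoungDiagram.mem_iff_lt_colLen, ne_eq, Prod.mk.injEq,
    Function.update_apply]
  split_ifs with hq
  · subst hq
    omega
  · simp [hq]

theorem numSYT_of_card_eq_zero (hμ : μ.card = 0) : numSYT μ = 1 := by
  have : IsEmpty μ.cells := Finset.isEmpty_coe_sort.2 (Finset.card_eq_zero.1 hμ)
  rw [numSYT_eq_card_naturalLabelling, hμ]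
  exact NaturalLabelling.card_of_isEmpty

theorem numSYT_eq_sum_removeCorner (hμ : μ.card ≠ 0) {K : ℕ} (hK : μ.rowLen 0 ≤ K) :
    numSYT μ = ∑ p ∈ Finset.range K with μ.colLen (p + 1) < μ.colLen p,
      numSYT (removeCorner μ p) := by
  classical
  obtain ⟨N, hN⟩ := Nat.exists_eq_succ_of_ne_zero hμ
  rw [numSYT_eq_card_naturalLabelling, hN, NaturalLabelling.card_succ]
  refine Finset.sum_nbij' Prod.snd (fun p => (μ.colLen p - 1, p)) ?_ ?_ ?_ ?_ ?_
  · rintro ⟨i, p⟩ hc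
    have hp := (maximal_mem_cells_iff.1 (Finset.mem_filter.1 hc).2).2
    have hK' : p < K := (lt_colLen_iff_lt_rowLen.1 (Nat.zero_lt_of_lt hp)).trans_le hK
    exact Finset.mem_filter.2 ⟨Finset.mem_range.2 hK', hp⟩
  · intro p hp
    have hmax := maximal_mem_cells_iff.2 ⟨rfl, (Finset.mem_filter.1 hp).2⟩
    exact Finset.mem_filter.2 ⟨hmax.prop, hmax⟩
  · rintro ⟨i, p⟩ hc
    rw [(maximal_mem_cells_iff.1 (Finset.mem_filter.1 hc).2).1]
  · exact fun _ _ => rfl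
  · rintro ⟨i, p⟩ hc
    obtain ⟨rfl, hp⟩ := maximal_mem_cells_iff.1 (Finset.mem_filter.1 hc).2
    rw [numSYT_eq_card_naturalLabelling, cells_removeCorner hp,
      show (removeCorner μ p).card = N by have := card_removeCorner hp; omega]

end Corners

section Coefficients

open Matrix

/-- The coefficient of `z ^ m` in `z ^ j * exp (x * z)`. -/
noncomputable def expCoeff (x : ℝ) (j m : ℕ) : ℝ :=
  if j ≤ m then x ^ (m - j) / (m - j)! else 0

theorem mul_expCoeff (x : ℝ) (j m : ℕ) :
    x * expCoeff x j m = ((m + 1 : ℕ) - j) * expCoeff x j (m + 1) := by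
  rcases lt_trichotomy j (m + 1) with hj | rfl | hj
  · obtain ⟨k, rfl⟩ := Nat.exists_eq_add_of_le (Nat.lt_succ_iff.1 hj)
    simp only [expCoeff, Nat.le_add_right, add_assoc, if_true, Nat.add_sub_cancel_left,
      Nat.factorial_succ]
    push_cast
    field_simp
    ring
  · simp [expCoeff]
  · simp [expCoeff, show ¬ j ≤ m by omega, show ¬ j ≤ m + 1 by omega]

/-- The entries of the determinants counting standard tableaux whose first row sticks out by `s`
cells. The column `j = 0` has a factor `m / (m + s)`, written so that the junk value `0 / 0 = 0`
makes it `1` throughout for `s = 0`. -/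
noncomputable def armCoeff (x : ℝ) (s j m : ℕ) : ℝ :=
  if j = 0 then (1 - s / (m + s)) * expCoeff x 0 m else expCoeff x j m

/-- The entry `x * armCoeff x s j (m - 1)`, with value `0` for `m = 0`. -/
noncomputable def armCoeffPred (x : ℝ) (s j : ℕ) : ℕ → ℝ
  | 0 => 0
  | m + 1 => x * armCoeff x s j m

theorem armCoeff_zero_zero {s : ℕ} (hs : s ≠ 0) (x : ℝ) (j : ℕ) : armCoeff x s j 0 = 0 := by
  rcases j with _ | j <;> simp [armCoeff, expCoeff, hs]

theorem armCoeff_zero_arm (x : ℝ) (j m : ℕ) : armCoeff x 0 j m = expCoeff x j m := by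
  rcases j with _ | j <;> simp [armCoeff]

theorem armCoeff_succ_col (x : ℝ) (s j m : ℕ) : armCoeff x s (j + 1) m = expCoeff x (j + 1) m :=
  if_neg j.succ_ne_zero

theorem armCoeffPred_succ_col (x : ℝ) (s j m : ℕ) :
    armCoeffPred x s (j + 1) m = (m - (j + 1 : ℕ)) * armCoeff x s (j + 1) m := by
  rcases m with _ | m
  · simp [armCoeffPred, armCoeff, expCoeff]
  · simp only [armCoeffPred, armCoeff_succ_col, mul_expCoeff]

theorem armCoeffPred_zero_col (x : ℝ) {s m : ℕ} (hs : s ≠ 0 → m ≠ 0) :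
    armCoeffPred x s 0 m = (m + s) * armCoeff x s 0 m - s * armCoeff x (s - 1) 0 m := by
  rcases m with _ | m
  · simp [armCoeffPred, show s = 0 by tauto]
  have hrec := mul_expCoeff x 0 m
  simp only [armCoeffPred, armCoeff, if_true, mul_left_comm x, hrec]
  rcases s with _ | s
  · simp
  · rw [Nat.add_sub_cancel]
    push_cast
    field_simp
    ring

/-- The matrix `armCoeff x s j (h i)` whose determinant counts the standard tableaux of the diagram
with arm `s` and bead positions `h`. -/
noncomputable def armMatrix (x : ℝ) (s : ℕ) {L : ℕ} (h : Fin L → ℕ) : Matrix (Fin L) (Fin L) ℝ :=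
  of fun i j => armCoeff x s j (h i)

theorem det_armMatrix_eq_zero {x : ℝ} {s L : ℕ} {h : Fin L → ℕ} (hs : s ≠ 0) {i : Fin L}
    (hi : h i = 0) : (armMatrix x s h).det = 0 :=
  det_eq_zero_of_row_eq_zero i fun j => by rw [armMatrix, of_apply, hi, armCoeff_zero_zero hs]

theorem det_armMatrix_id (x : ℝ) (L : ℕ) : (armMatrix x 0 fun i : Fin L => (i : ℕ)).det = 1 := by
  have hlower : (armMatrix x 0 fun i : Fin L => (i : ℕ)).IsLowerTriangular :=
    fun i j hij => by
      simp [armMatrix, armCoeff_zero_arm, expCoeff, show ¬ j ≤ i from not_le.2 hij]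
  rw [det_of_isLowerTriangular _ hlower]
  simp [armMatrix, armCoeff_zero_arm, expCoeff]

section

variable {x : ℝ} {s L : ℕ} {h : Fin L → ℕ}

theorem armMatrix_update (i : Fin L) (m : ℕ) : armMatrix x s (Function.update h i m) =
    (armMatrix x s h).updateRow i fun j => armCoeff x s j m := by
  ext k j
  by_cases hk : k = i
  · subst hk
    simp [armMatrix]
  · simp [armMatrix, hk]

theorem det_updateRow_armCoeffPred_succ (i : Fin L) (m : ℕ) :
    ((armMatrix x s h).updateRow i fun j => armCoeffPred x s j (m + 1)).det =
      x * (armMatrix x s (Function.update h i m)).det := by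
  rw [armMatrix_update, ← det_updateRow_smul]
  rfl

theorem of_armCoeffPred_eq {h : Fin (L + 1) → ℕ} (hs : s ≠ 0 → ∀ i, h i ≠ 0) :
    (of fun i (j : Fin (L + 1)) => armCoeffPred x s j (h i)) =
      diagonal (fun i => (h i : ℝ)) * armMatrix x s h
        - armMatrix x s h * diagonal (fun j : Fin (L + 1) => ((j : ℕ) : ℝ))
        + (s : ℝ) • vecMulVec (fun i => armCoeff x s 0 (h i)) (Pi.single 0 1)
        - (s : ℝ) • vecMulVec (fun i => armCoeff x (s - 1) 0 (h i)) (Pi.single 0 1) := by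
  ext i j
  simp only [armMatrix, of_apply, Matrix.sub_apply, Matrix.add_apply, Matrix.smul_apply,
    diagonal_mul, mul_diagonal, vecMulVec_apply, smul_eq_mul]
  induction j using Fin.cases with
  | zero =>
    rw [Fin.val_zero, armCoeffPred_zero_col x fun hs' => hs hs' i, Pi.single_eq_same]
    push_cast
    ring
  | succ j =>
    rw [Fin.val_succ, armCoeffPred_succ_col, Pi.single_eq_of_ne j.succ_ne_zero]
    ring

theorem armMatrix_updateCol_zero {t : ℕ} {h : Fin (L + 1) → ℕ} :
    (armMatrix x s h).updateCol 0 (fun i => armCoeff x t 0 (h i)) = armMatrix x t h := by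
  ext i j
  induction j using Fin.cases with
  | zero => simp [armMatrix]
  | succ j => simp [armMatrix, armCoeff_succ_col]

theorem sum_det_updateRow_armCoeffPred (hs : s ≠ 0 → ∀ i, h i ≠ 0) :
    ∑ i, ((armMatrix x s h).updateRow i fun j => armCoeffPred x s j (h i)).det =
      (∑ i, (h i : ℝ) - ∑ i : Fin L, ((i : ℕ) : ℝ) + s) * (armMatrix x s h).det
        - s * (armMatrix x (s - 1) h).det := by
  rcases L with _ | L
  · simp
  refine (sum_det_updateRow (armMatrix x s h)
    (of fun i (j : Fin (L + 1)) => armCoeffPred x s j (h i))).trans ?_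
  rw [of_armCoeffPred_eq hs, Matrix.sub_mul, Matrix.add_mul, Matrix.sub_mul, smul_mul, smul_mul,
    trace_sub, trace_add, trace_sub, trace_smul, trace_smul, trace_mul_mul_adjugate,
    trace_mul_mul_adjugate', trace_vecMulVec_single_mul_adjugate,
    trace_vecMulVec_single_mul_adjugate, armMatrix_updateCol_zero, armMatrix_updateCol_zero,
    trace_diagonal, trace_diagonal, smul_eq_mul, smul_eq_mul]
  ring

end

end Coefficients

section DeterminantFormula

variable {μ ν : YoungDiagram} {L p : ℕ}

theorem rowLen_sub_eq_of_colLen_eq (h : ∀ q, L ≤ q → ν.colLen q = μ.colLen q) (i : ℕ) :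
    ν.rowLen i - L = μ.rowLen i - L := by
  refine eq_of_forall_lt_iff fun k => ?_
  rw [lt_tsub_iff_left, lt_tsub_iff_left, ← lt_colLen_iff_lt_rowLen, ← lt_colLen_iff_lt_rowLen,
    h _ (L.le_add_right k)]

theorem colLen_eq_ite (hμ : μ.rowLen 1 ≤ L) (hp : L ≤ p) :
    μ.colLen p = if p < μ.rowLen 0 then 1 else 0 := by
  have hone : ¬ 1 < μ.colLen p := by
    rw [lt_colLen_iff_lt_rowLen]
    omega
  have hzero := lt_colLen_iff_lt_rowLen (μ := μ) (i := 0) (j := p)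
  split_ifs <;> omega

/-- The positions `μ.colLen (L - 1 - i) + i` of the beads encoding the first `L` columns of `μ`;
they increase strictly with `i`. -/
def profile (L : ℕ) (μ : YoungDiagram) (i : Fin L) : ℕ := μ.colLen i.rev + i

theorem profile_strictMono (L : ℕ) (μ : YoungDiagram) : StrictMono (profile L μ) := fun _ _ hij =>
  add_lt_add_of_le_of_lt (μ.colLen_anti _ _ (Fin.rev_le_rev.2 hij.le)) hij

theorem profile_eq_of_colLen_eq (h : ∀ q < L, ν.colLen q = μ.colLen q) :
    profile L ν = profile L μ :=
  funext fun i => congrArg (· + (i : ℕ)) (h _ i.rev.isLt)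

theorem profile_ne_zero (hμ : μ.rowLen 0 - L ≠ 0) (i : Fin L) : profile L μ i ≠ 0 := by
  have : 0 < μ.colLen i.rev := lt_colLen_iff_lt_rowLen.2 (by omega)
  unfold profile
  omega

theorem profile_removeCorner {i : Fin L} (hi : μ.colLen (i.rev + 1) < μ.colLen i.rev) :
    profile L (removeCorner μ i.rev) = Function.update (profile L μ) i (profile L μ i - 1) := by
  ext k
  rw [profile, colLen_removeCorner hi]
  by_cases hk : k = i
  · subst hk
    rw [Function.update_self, Function.update_self, profile]
    omega
  · rw [Function.update_of_ne hk,
      Function.update_of_ne (Fin.val_injective.ne (Fin.rev_injective.ne hk)), profile]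

theorem sum_profile_add (hμ : μ.rowLen 1 ≤ L) :
    ∑ i, (profile L μ i : ℝ) - ∑ i : Fin L, ((i : ℕ) : ℝ) + (μ.rowLen 0 - L : ℕ) = μ.card := by
  have hcols : ∑ i, profile L μ i = ∑ p ∈ Finset.range L, μ.colLen p + ∑ i : Fin L, (i : ℕ) := by
    rw [← Fin.sum_univ_eq_sum_range, ← Equiv.sum_comp Fin.revPerm (fun p : Fin L => μ.colLen p),
      ← Finset.sum_add_distrib]
    rfl
  have harm : ∑ k ∈ Finset.range (μ.rowLen 0 - L), μ.colLen (L + k) = μ.rowLen 0 - L := by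
    rw [Finset.sum_congr rfl fun k hk => ?_, Finset.sum_const, Finset.card_range, smul_eq_mul,
      mul_one]
    rw [colLen_eq_ite hμ (L.le_add_right k), if_pos]
    have := Finset.mem_range.1 hk
    omega
  rw [card_eq_sum_colLen (K := L + (μ.rowLen 0 - L)) (by omega), Finset.sum_range_add, harm]
  have := congrArg (Nat.cast (R := ℝ)) hcols
  push_cast at this ⊢
  linarith

/-- The quantity `x ^ N * d_μ / N!` for `N = μ.card`; its square is the weight of `μ` in the
Poissonized Plancherel measure of parameter `x ^ 2`, up to the factor `exp (-x ^ 2)`. -/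
noncomputable def amplitude (x : ℝ) (μ : YoungDiagram) : ℝ := x ^ μ.card * numSYT μ / μ.card !

theorem card_mul_amplitude (x : ℝ) {K : ℕ} (hK : μ.rowLen 0 ≤ K) :
    μ.card * amplitude x μ = x * ∑ p ∈ Finset.range K with μ.colLen (p + 1) < μ.colLen p,
      amplitude x (removeCorner μ p) := by
  rcases eq_or_ne μ.card 0 with hμ | hμ
  · rw [hμ, Finset.filter_false_of_mem fun p _ hp => ?_]
    · simp
    · have := card_removeCorner hp
      omega
  · obtain ⟨N, hN⟩ := Nat.exists_eq_add_one_of_ne_zero hμ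
    rw [amplitude, numSYT_eq_sum_removeCorner hμ hK, hN, Nat.cast_sum, Finset.mul_sum,
      Finset.mul_sum, Finset.sum_div, Finset.mul_sum]
    refine Finset.sum_congr rfl fun p hp => ?_
    have hcard : (removeCorner μ p).card = N := by
      have := card_removeCorner (Finset.mem_filter.1 hp).2
      omega
    rw [amplitude, hcard, Nat.factorial_succ]
    push_cast
    field_simp
    ring

theorem sum_arm_corners {A : Type*} [AddCommMonoid A] (hμ : μ.rowLen 1 ≤ L) (f : ℕ → A) :
    (∑ k ∈ Finset.range (μ.rowLen 0 - L),
      if μ.colLen (L + k + 1) < μ.colLen (L + k) then f (L + k) else 0) =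
    if μ.rowLen 0 - L = 0 then 0 else f (μ.rowLen 0 - 1) := by
  split_ifs with hs
  · simp [hs]
  have hcorner (k : ℕ) (hk : k ∈ Finset.range (μ.rowLen 0 - L)) :
      μ.colLen (L + k + 1) < μ.colLen (L + k) ↔ k = μ.rowLen 0 - L - 1 := by
    have := Finset.mem_range.1 hk
    rw [colLen_eq_ite hμ (by omega), colLen_eq_ite hμ (by omega)]
    split_ifs <;> omega
  rw [Finset.sum_congr rfl fun k hk => if_congr (hcorner k hk) rfl rfl, Finset.sum_ite_eq',
    if_pos (Finset.mem_range.2 (by omega))]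
  congr 1
  omega

theorem det_updateRow_profile_of_corner (x : ℝ) (s : ℕ) {i : Fin L}
    (hi : μ.colLen (i.rev + 1) < μ.colLen i.rev) :
    ((armMatrix x s (profile L μ)).updateRow i fun j => armCoeffPred x s j (profile L μ i)).det =
      x * (armMatrix x s (profile L (removeCorner μ i.rev))).det := by
  obtain ⟨m, hm⟩ : ∃ m, profile L μ i = m + 1 :=
    Nat.exists_eq_add_one.2 (Nat.add_pos_left (Nat.zero_lt_of_lt hi) _)
  rw [profile_removeCorner hi, hm, det_updateRow_armCoeffPred_succ, Nat.add_sub_cancel]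

-- A bead that cannot move down is blocked by the next bead, which makes two rows proportional, or
-- by the bottom, where its new row vanishes.
theorem det_updateRow_profile_of_not_corner (x : ℝ) (hμ : μ.rowLen 1 ≤ L) {i : Fin L}
    (hi : ¬ μ.colLen (i.rev + 1) < μ.colLen i.rev) :
    ((armMatrix x (μ.rowLen 0 - L) (profile L μ)).updateRow i fun j =>
      armCoeffPred x (μ.rowLen 0 - L) j (profile L μ i)).det = 0 := by
  have hcol : μ.colLen (i.rev + 1) = μ.colLen i.rev :=
    le_antisymm (μ.colLen_anti _ _ (Nat.le_succ _)) (not_lt.1 hi)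
  obtain ⟨i, hiL⟩ := i
  rcases i with _ | k
  · refine Matrix.det_eq_zero_of_row_eq_zero ⟨0, hiL⟩ fun j => ?_
    have hzero : profile L μ ⟨0, hiL⟩ = if L < μ.rowLen 0 then 1 else 0 := by
      rw [← colLen_eq_ite hμ le_rfl, profile, ← hcol, Fin.val_rev]
      simp [Nat.sub_add_cancel (Nat.one_le_of_lt hiL)]
    rw [Matrix.updateRow_self, hzero]
    split_ifs with harm
    · rw [armCoeffPred, armCoeff_zero_zero (by omega), mul_zero]
    · rfl
  · let k' : Fin L := ⟨k, by omega⟩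
    have hrev : ((⟨k + 1, hiL⟩ : Fin L).rev : ℕ) + 1 = k'.rev := by
      simp only [Fin.val_rev, k']
      omega
    have hblocked : profile L μ ⟨k + 1, hiL⟩ = profile L μ k' + 1 := by
      rw [profile, profile, ← hcol, hrev, add_assoc]
    have hne : (⟨k + 1, hiL⟩ : Fin L) ≠ k' := by simp [k', Fin.ext_iff]
    rw [hblocked, det_updateRow_armCoeffPred_succ, Matrix.det_zero_of_row_eq hne, mul_zero]
    ext j
    simp [armMatrix, hne.symm]

theorem rowLen_removeCorner_of_lt (hp : μ.colLen (p + 1) < μ.colLen p) (hpL : p < L) (i : ℕ) :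
    (removeCorner μ p).rowLen i - L = μ.rowLen i - L :=
  rowLen_sub_eq_of_colLen_eq (fun q hq => by
    rw [colLen_removeCorner hp, Function.update_of_ne (hpL.trans_le hq).ne']) i

theorem rowLen_removeCorner_le (μ : YoungDiagram) (p i : ℕ) :
    (removeCorner μ p).rowLen i ≤ μ.rowLen i := by
  refine le_of_forall_lt fun k hk => ?_
  rw [← YoungDiagram.mem_iff_lt_rowLen, ← YoungDiagram.mem_cells] at hk ⊢
  exact Finset.mem_of_mem_filter _ hk

theorem rowLen_zero_removeCorner_last (hlast : μ.rowLen 0 = p + 1) (hone : μ.colLen p = 1) :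
    (removeCorner μ p).rowLen 0 = p := by
  have hnext := lt_colLen_iff_lt_rowLen (μ := μ) (i := 0) (j := p + 1)
  refine eq_of_forall_lt_iff fun q => ?_
  have hq := lt_colLen_iff_lt_rowLen (μ := μ) (i := 0) (j := q)
  rw [← lt_colLen_iff_lt_rowLen, colLen_removeCorner (by omega), Function.update_apply]
  split_ifs <;> omega

/-- The determinantal expression for `amplitude x μ`, valid if only the first row of `μ` reaches
beyond its first `L` columns. -/
noncomputable def armDet (x : ℝ) (L : ℕ) (μ : YoungDiagram) : ℝ :=
  x ^ (μ.rowLen 0 - L) / (μ.rowLen 0 - L)! * (armMatrix x (μ.rowLen 0 - L) (profile L μ)).det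

theorem mul_armDet_removeCorner_rev (x : ℝ) {i : Fin L}
    (hi : μ.colLen (i.rev + 1) < μ.colLen i.rev) :
    x * armDet x L (removeCorner μ i.rev) = x ^ (μ.rowLen 0 - L) / (μ.rowLen 0 - L)! *
      ((armMatrix x (μ.rowLen 0 - L) (profile L μ)).updateRow i fun j =>
        armCoeffPred x (μ.rowLen 0 - L) j (profile L μ i)).det := by
  rw [armDet, rowLen_removeCorner_of_lt hi i.rev.isLt, det_updateRow_profile_of_corner x _ hi]
  ring

theorem mul_armDet_removeCorner_last (x : ℝ) (hμ : μ.rowLen 1 ≤ L) (hs : μ.rowLen 0 - L ≠ 0) :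
    x * armDet x L (removeCorner μ (μ.rowLen 0 - 1)) =
      x ^ (μ.rowLen 0 - L) / (μ.rowLen 0 - L)! * ((μ.rowLen 0 - L : ℕ) *
        (armMatrix x (μ.rowLen 0 - L - 1) (profile L μ)).det) := by
  obtain ⟨t, ht⟩ := Nat.exists_eq_add_one_of_ne_zero hs
  have hlast : μ.rowLen 0 = L + t + 1 := by omega
  have hone : μ.colLen (L + t) = 1 := by
    rw [colLen_eq_ite hμ (by omega), if_pos (by omega)]
  have hnext : μ.colLen (L + t + 1) = 0 := by
    rw [colLen_eq_ite hμ (by omega), if_neg (by omega)]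
  have hprofile : profile L (removeCorner μ (L + t)) = profile L μ :=
    profile_eq_of_colLen_eq fun q hq => by
      rw [colLen_removeCorner (by omega), Function.update_of_ne (by omega)]
  have hrow : (removeCorner μ (L + t)).rowLen 0 - L = t := by
    rw [rowLen_zero_removeCorner_last hlast hone, Nat.add_sub_cancel_left]
  rw [ht, hlast, Nat.add_sub_cancel, armDet, hrow, hprofile, Nat.add_sub_cancel,
    Nat.factorial_succ]
  push_cast
  field_simp
  ring

theorem card_mul_armDet (x : ℝ) (hμ : μ.rowLen 1 ≤ L) : μ.card * armDet x L μ =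
    x * ∑ p ∈ Finset.range (L + (μ.rowLen 0 - L)) with μ.colLen (p + 1) < μ.colLen p,
      armDet x L (removeCorner μ p) := by
  have hcols : x * (∑ p ∈ Finset.range L,
      if μ.colLen (p + 1) < μ.colLen p then armDet x L (removeCorner μ p) else 0) =
      x ^ (μ.rowLen 0 - L) / (μ.rowLen 0 - L)! *
        ∑ i, ((armMatrix x (μ.rowLen 0 - L) (profile L μ)).updateRow i fun j =>
          armCoeffPred x (μ.rowLen 0 - L) j (profile L μ i)).det := by
    rw [← Fin.sum_univ_eq_sum_range (fun p => if μ.colLen (p + 1) < μ.colLen p then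
        armDet x L (removeCorner μ p) else 0), ← Equiv.sum_comp Fin.revPerm, Finset.mul_sum,
      Finset.mul_sum]
    refine Finset.sum_congr rfl fun i _ => ?_
    rw [Fin.revPerm_apply]
    split_ifs with hi
    · exact mul_armDet_removeCorner_rev x hi
    · rw [det_updateRow_profile_of_not_corner x hμ hi, mul_zero, mul_zero]
  have harm : x * (if μ.rowLen 0 - L = 0 then 0 else
      armDet x L (removeCorner μ (μ.rowLen 0 - 1))) =
      x ^ (μ.rowLen 0 - L) / (μ.rowLen 0 - L)! * ((μ.rowLen 0 - L : ℕ) *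
        (armMatrix x (μ.rowLen 0 - L - 1) (profile L μ)).det) := by
    split_ifs with hs
    · simp [hs]
    · exact mul_armDet_removeCorner_last x hμ hs
  rw [Finset.sum_filter, Finset.sum_range_add,
    sum_arm_corners hμ fun p => armDet x L (removeCorner μ p), mul_add, hcols, harm,
    sum_det_updateRow_armCoeffPred profile_ne_zero, sum_profile_add hμ, armDet]
  ring

theorem amplitude_of_card_eq_zero (x : ℝ) (hμ : μ.card = 0) : amplitude x μ = 1 := by
  simp [amplitude, hμ, numSYT_of_card_eq_zero hμ]

theorem armDet_of_card_eq_zero (x : ℝ) (L : ℕ) (hμ : μ.card = 0) : armDet x L μ = 1 := by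
  have hcol (p : ℕ) : μ.colLen p = 0 := by
    rw [YoungDiagram.colLen_eq_card, ← Nat.le_zero, ← hμ]
    exact Finset.card_filter_le _ _
  have hrow : μ.rowLen 0 - L = 0 := by
    rw [← Nat.le_zero, ← hμ, YoungDiagram.rowLen_eq_card]
    exact (Nat.sub_le _ _).trans (Finset.card_filter_le _ _)
  have hprofile : profile L μ = fun i : Fin L => (i : ℕ) := by
    ext i
    rw [profile, hcol, zero_add]
  rw [armDet, hrow, hprofile, det_armMatrix_id]
  simp

theorem amplitude_eq_armDet (x : ℝ) (hμ : μ.rowLen 1 ≤ L) : amplitude x μ = armDet x L μ := by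
  induction hN : μ.card generalizing μ with
  | zero => rw [amplitude_of_card_eq_zero x hN, armDet_of_card_eq_zero x L hN]
  | succ N ih =>
    have hcard : (μ.card : ℝ) ≠ 0 := Nat.cast_ne_zero.2 (by omega)
    refine mul_left_cancel₀ hcard ?_
    rw [card_mul_amplitude x le_add_tsub, card_mul_armDet x hμ]
    refine congrArg (x * ·) (Finset.sum_congr rfl fun p hp => ?_)
    have := card_removeCorner (Finset.mem_filter.1 hp).2
    exact ih ((rowLen_removeCorner_le μ p 1).trans hμ) (by omega)

end DeterminantFormula

section Gram

open Matrix

theorem expCoeff_of_lt (x : ℝ) {j m : ℕ} (h : m < j) : expCoeff x j m = 0 :=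
  if_neg h.not_ge

theorem expCoeff_add (x : ℝ) (j m : ℕ) : expCoeff x j (m + j) = x ^ m / m ! := by
  simp [expCoeff]

theorem expCoeff_succ_succ (x : ℝ) (j m : ℕ) : expCoeff x (j + 1) (m + 1) = expCoeff x j m := by
  simp [expCoeff]

theorem abs_expCoeff (x : ℝ) (j m : ℕ) : |expCoeff x j m| = expCoeff |x| j m := by
  unfold expCoeff
  split_ifs <;> simp [abs_div]

theorem summable_expCoeff (x : ℝ) (j : ℕ) : Summable (expCoeff x j) := by
  rw [← summable_nat_add_iff j]
  simpa only [expCoeff_add] using Real.summable_pow_div_factorial x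

theorem summable_expCoeff_mul_prod (x : ℝ) (j k : ℕ) :
    Summable fun p : ℕ × ℕ => expCoeff x j p.1 * expCoeff x k p.2 :=
  summable_mul_of_summable_norm (summable_expCoeff x j).norm (summable_expCoeff x k).norm

theorem abs_armCoeff_le (x : ℝ) (s j m : ℕ) : |armCoeff x s j m| ≤ expCoeff |x| j m := by
  rw [← abs_expCoeff]
  unfold armCoeff
  split_ifs with hj
  · have hle : (s : ℝ) / (m + s) ≤ 1 := div_le_one_of_le₀ (by simp) (by positivity)
    have hnonneg : (0 : ℝ) ≤ s / (m + s) := by positivity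
    rw [hj, abs_mul, abs_of_nonneg (sub_nonneg.2 hle)]
    exact mul_le_of_le_one_left (abs_nonneg _) (sub_le_self _ hnonneg)
  · exact le_rfl

theorem norm_armCoeff_mul_le (x : ℝ) (s j k m : ℕ) :
    ‖armCoeff x s j m * armCoeff x s k m‖ ≤ expCoeff |x| j m * expCoeff |x| k m := by
  rw [norm_mul]
  exact mul_le_mul (abs_armCoeff_le ..) (abs_armCoeff_le ..) (abs_nonneg _)
    ((abs_nonneg _).trans (abs_armCoeff_le x s j m))

theorem summable_expCoeff_mul (x : ℝ) (j k : ℕ) :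
    Summable fun m => expCoeff x j m * expCoeff x k m :=
  (summable_expCoeff_mul_prod x j k).comp_injective (i := fun m : ℕ => (m, m))
    fun _ _ h => congrArg Prod.fst h

theorem summable_armCoeff_mul (x : ℝ) (s j k : ℕ) :
    Summable fun m => armCoeff x s j m * armCoeff x s k m :=
  (summable_expCoeff_mul |x| j k).of_norm_bounded (norm_armCoeff_mul_le x s j k)

/-- The Gram matrix in `ℓ²` of the sequences `armCoeff x s j`, `j < L`. For `s = 0` it is the
Toeplitz matrix of the weight `exp (2 * x * cos θ)`. -/
noncomputable def armGram (x : ℝ) (s L : ℕ) : Matrix (Fin L) (Fin L) ℝ :=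
  of fun j k => ∑' m, armCoeff x s j m * armCoeff x s k m

theorem armGram_comm (x : ℝ) (s : ℕ) {L : ℕ} (j k : Fin L) :
    armGram x s L j k = armGram x s L k j :=
  tsum_congr fun _ => mul_comm _ _

theorem hasSum_det_armMatrix_sq (x : ℝ) (s L : ℕ) :
    HasSum (fun h : Fin L → ℕ => if StrictMono h then (armMatrix x s h).det ^ 2 else 0)
      (armGram x s L).det :=
  hasSum_strictMono_det_sq (fun j : Fin L => armCoeff x s j) fun _ _ =>
    summable_armCoeff_mul x s _ _

theorem det_armGram_nonneg (x : ℝ) (s L : ℕ) : 0 ≤ (armGram x s L).det :=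
  (hasSum_det_armMatrix_sq x s L).nonneg fun h => by split_ifs <;> positivity

theorem det_armGram_zero_pos (x : ℝ) (L : ℕ) : 0 < (armGram x 0 L).det := by
  have hle := le_hasSum (hasSum_det_armMatrix_sq x 0 L) (fun i => (i : ℕ))
    fun h _ => by split_ifs <;> positivity
  rw [if_pos Fin.val_strictMono, det_armMatrix_id, one_pow] at hle
  exact one_pos.trans_le hle

theorem abs_armGram_le (x : ℝ) (s : ℕ) {L : ℕ} (j k : Fin L) :
    |armGram x s L j k| ≤ ∑' m, expCoeff |x| j m * expCoeff |x| k m :=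
  tsum_of_norm_bounded (summable_expCoeff_mul |x| j k).hasSum (norm_armCoeff_mul_le x s j k)

theorem exists_forall_det_armGram_le (x : ℝ) (L : ℕ) : ∃ C, ∀ s, (armGram x s L).det ≤ C := by
  obtain ⟨B, hB⟩ := (Set.finite_range fun p : Fin L × Fin L =>
    ∑' m, expCoeff |x| p.1 m * expCoeff |x| p.2 m).bddAbove
  refine ⟨_, fun s => (le_abs_self _).trans
    (det_le (abv := AbsoluteValue.abs) (x := B) fun j k => ?_)⟩
  exact (abs_armGram_le x s j k).trans (hB ⟨(j, k), rfl⟩)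

theorem summable_det_armGram (x : ℝ) (L : ℕ) :
    Summable fun s : ℕ => (x ^ 2) ^ s / (s ! : ℝ) ^ 2 * (armGram x s L).det := by
  obtain ⟨C, hC⟩ := exists_forall_det_armGram_le x L
  refine ((Real.summable_pow_div_factorial (x ^ 2)).mul_right C).of_nonneg_of_le
    (fun s => mul_nonneg (by positivity) (det_armGram_nonneg x s L)) fun s => ?_
  have hfact : (1 : ℝ) ≤ s ! := by exact_mod_cast s.factorial_pos
  refine mul_le_mul ?_ (hC s) (det_armGram_nonneg x s L) (by positivity)
  exact div_le_div_of_nonneg_left (by positivity) (by positivity) (le_self_pow₀ hfact two_ne_zero)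

end Gram

section GramEntries

open Matrix

theorem armGram_submatrix_succ (x : ℝ) (s n : ℕ) :
    (armGram x s (n + 1)).submatrix Fin.succ Fin.succ = armGram x 0 n := by
  ext j k
  simp only [armGram, submatrix_apply, of_apply, Fin.val_succ, armCoeff_succ_col,
    armCoeff_zero_arm]
  rw [(summable_expCoeff_mul x _ _).tsum_eq_zero_add, expCoeff_of_lt x j.val.succ_pos, zero_mul,
    zero_add]
  simp only [expCoeff_succ_succ]

theorem armCoeff_zero_succ (x : ℝ) (s i : ℕ) :
    armCoeff x s 0 (i + 1) = x ^ (i + 1) / (((i : ℝ) + 1 + s) * i !) := by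
  simp only [armCoeff, if_true, expCoeff, Nat.zero_le, Nat.sub_zero, Nat.factorial_succ]
  push_cast
  field_simp
  ring

theorem armGram_zero_zero (x : ℝ) (s n : ℕ) : armGram x s (n + 1) 0 0 = aZero (x ^ 2) s := by
  simp only [armGram, of_apply, Fin.val_zero, aZero]
  split_ifs with hs
  · refine tsum_congr fun m => ?_
    rw [hs, armCoeff_zero_arm, ← add_zero m, expCoeff_add, add_zero, div_mul_div_comm]
    ring
  · rw [(summable_armCoeff_mul x s _ _).tsum_eq_zero_add, armCoeff_zero_zero hs, zero_mul, zero_add]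
    refine tsum_congr fun i => ?_
    rw [armCoeff_zero_succ, div_mul_div_comm]
    congr 1 <;> ring

theorem sq_rpow_add_half {x : ℝ} (hx : 0 ≤ x) (i j : ℕ) :
    (x ^ 2) ^ ((i : ℝ) + (j : ℝ) / 2) = x ^ (i + j) * x ^ i := by
  rw [← Real.rpow_natCast x 2, ← Real.rpow_mul hx, ← pow_add, ← Real.rpow_natCast]
  congr 1
  push_cast
  ring

theorem armGram_zero_succ {x : ℝ} (hx : 0 ≤ x) (s : ℕ) {n : ℕ} (j : Fin n) :
    armGram x s (n + 1) 0 j.succ = a (x ^ 2) (j + 1) s := by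
  simp only [armGram, of_apply, Fin.val_zero, a, Fin.val_succ]
  rw [← (summable_armCoeff_mul x s _ _).sum_add_tsum_nat_add (j + 1), Finset.sum_eq_zero, zero_add]
  · refine tsum_congr fun i => ?_
    rw [armCoeff_succ_col, expCoeff_add, ← add_assoc, armCoeff_zero_succ, div_mul_div_comm,
      sq_rpow_add_half hx, ← add_assoc, Nat.add_sub_cancel]
    congr 1
    push_cast
    ring
  · intro m hm
    rw [armCoeff_succ_col, expCoeff_of_lt x (Finset.mem_range.1 hm), mul_zero]

end GramEntries

section Toeplitz

theorem hasSum_expCoeff_mul_pow (x : ℝ) (k : ℕ) (z : ℂ) :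
    HasSum (fun m => (expCoeff x k m : ℂ) * z ^ m) (z ^ k * Complex.exp (x * z)) := by
  have hshift : HasSum (fun m => (expCoeff x k (m + k) : ℂ) * z ^ (m + k))
      (z ^ k * Complex.exp (x * z)) := by
    have hexp := (NormedSpace.expSeries_div_hasSum_exp (x * z : ℂ)).mul_left (z ^ k)
    rw [← Complex.exp_eq_exp_ℂ] at hexp
    refine hexp.congr_fun fun m => ?_
    rw [expCoeff_add]
    push_cast
    ring
  rwa [hasSum_nat_add_iff (f := fun m => (expCoeff x k m : ℂ) * z ^ m) k, Finset.sum_eq_zero,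
    add_zero] at hshift
  intro m hm
  rw [expCoeff_of_lt x (Finset.mem_range.1 hm), Complex.ofReal_zero, zero_mul]

theorem integral_exp_I_mul_sub (m m' : ℕ) :
    ∫ θ in (0 : ℝ)..2 * Real.pi, Complex.exp (Complex.I * ((m : ℂ) - m') * θ) =
      if m = m' then 2 * Real.pi else 0 := by
  split_ifs with h
  · simp [h]
  · have hc : Complex.I * ((m : ℂ) - m') ≠ 0 :=
      mul_ne_zero Complex.I_ne_zero (sub_ne_zero.2 (by exact_mod_cast h))
    have hperiod : Complex.I * ((m : ℂ) - m') * ((2 * Real.pi : ℝ) : ℂ) =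
        ((m - m' : ℤ) : ℂ) * (2 * Real.pi * Complex.I) := by
      push_cast
      ring
    rw [integral_exp_mul_complex hc, hperiod, Complex.exp_int_mul_two_pi_mul_I]
    simp

/-- The `(m, m')`-th term of the double Fourier series obtained by expanding both factors of
`exp (2 * x * cos θ) = exp (x * exp (I * θ)) * exp (x * exp (-(I * θ)))`,
times `exp (I * (k - j) * θ)`. -/
noncomputable def fourierTerm (x : ℝ) (j k : ℕ) (p : ℕ × ℕ) (θ : ℝ) : ℂ :=
  (expCoeff x k p.1 * expCoeff x j p.2 : ℝ) * Complex.exp (Complex.I * ((p.1 : ℂ) - p.2) * θ)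

theorem norm_fourierTerm (x : ℝ) (j k : ℕ) (p : ℕ × ℕ) (θ : ℝ) :
    ‖fourierTerm x j k p θ‖ = ‖expCoeff x k p.1 * expCoeff x j p.2‖ := by
  have harg : Complex.I * ((p.1 : ℂ) - p.2) * θ = (((p.1 : ℝ) - p.2) * θ : ℝ) * Complex.I := by
    push_cast
    ring
  rw [fourierTerm, norm_mul, harg, Complex.norm_exp_ofReal_mul_I, mul_one, Complex.norm_real]

theorem fourierTerm_eq_mul (x : ℝ) (j k : ℕ) (p : ℕ × ℕ) (θ : ℝ) :
    fourierTerm x j k p θ = ((expCoeff x k p.1 : ℂ) * Complex.exp (Complex.I * θ) ^ p.1) *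
      ((expCoeff x j p.2 : ℂ) * Complex.exp (-(Complex.I * θ)) ^ p.2) := by
  rw [← Complex.exp_nat_mul, ← Complex.exp_nat_mul, mul_mul_mul_comm, ← Complex.exp_add,
    fourierTerm]
  push_cast
  congr 2
  ring

theorem exp_mul_exp_two_mul_cos (x : ℝ) (j k : ℕ) (θ : ℝ) :
    Complex.exp (-Complex.I * ((j : ℂ) - k) * θ) * (Real.exp (2 * x * Real.cos θ) : ℂ) =
      Complex.exp (Complex.I * θ) ^ k * Complex.exp (x * Complex.exp (Complex.I * θ)) *
        (Complex.exp (-(Complex.I * θ)) ^ j *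
          Complex.exp (x * Complex.exp (-(Complex.I * θ)))) := by
  rw [← Complex.exp_nat_mul, ← Complex.exp_nat_mul, Complex.ofReal_exp, mul_mul_mul_comm]
  simp only [← Complex.exp_add]
  congr 1
  push_cast
  rw [Complex.cos, neg_mul (θ : ℂ), mul_comm (θ : ℂ) Complex.I]
  ring

theorem hasSum_fourierTerm (x : ℝ) (j k : ℕ) (θ : ℝ) :
    HasSum (fun p => fourierTerm x j k p θ)
      (Complex.exp (-Complex.I * ((j : ℂ) - k) * θ) * (Real.exp (2 * x * Real.cos θ) : ℂ)) := by
  have hsummable : Summable fun p => fourierTerm x j k p θ :=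
    .of_norm (by simpa only [norm_fourierTerm] using (summable_expCoeff_mul_prod x k j).norm)
  simp only [fourierTerm_eq_mul] at hsummable
  have hprod := (hasSum_expCoeff_mul_pow x k (Complex.exp (Complex.I * θ))).mul
    (hasSum_expCoeff_mul_pow x j (Complex.exp (-(Complex.I * θ)))) hsummable
  rw [exp_mul_exp_two_mul_cos]
  exact hprod.congr_fun fun p => fourierTerm_eq_mul x j k p θ

theorem hasSum_integral_fourierTerm (x : ℝ) (j k : ℕ) :
    HasSum (fun p => ∫ θ in (0 : ℝ)..2 * Real.pi, fourierTerm x j k p θ)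
      (∫ θ in (0 : ℝ)..2 * Real.pi, Complex.exp (-Complex.I * ((j : ℂ) - k) * θ) *
        (Real.exp (2 * x * Real.cos θ) : ℂ)) :=
  intervalIntegral.hasSum_integral_of_dominated_convergence
    (fun p _ => ‖expCoeff x k p.1 * expCoeff x j p.2‖)
    (fun p => Continuous.aestronglyMeasurable (by unfold fourierTerm; fun_prop))
    (fun p => .of_forall fun θ _ => (norm_fourierTerm x j k p θ).le)
    (.of_forall fun _ _ => (summable_expCoeff_mul_prod x k j).norm)
    intervalIntegrable_const
    (.of_forall fun θ _ => hasSum_fourierTerm x j k θ)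

theorem integral_fourierTerm (x : ℝ) (j k : ℕ) (p : ℕ × ℕ) :
    ∫ θ in (0 : ℝ)..2 * Real.pi, fourierTerm x j k p θ =
      (expCoeff x k p.1 * expCoeff x j p.2 : ℝ) * if p.1 = p.2 then 2 * Real.pi else 0 := by
  simp only [fourierTerm, intervalIntegral.integral_const_mul, integral_exp_I_mul_sub]

theorem integral_exp_mul_exp_cos (x : ℝ) (j k : ℕ) :
    ∫ θ in (0 : ℝ)..2 * Real.pi, Complex.exp (-Complex.I * ((j : ℂ) - k) * θ) *
      (Real.exp (2 * x * Real.cos θ) : ℂ) / (2 * Real.pi) =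
    ((∑' m, expCoeff x j m * expCoeff x k m : ℝ) : ℂ) := by
  have hdiag : Function.Injective fun m : ℕ => (m, m) := fun _ _ h => congrArg Prod.fst h
  have hsum := (hdiag.hasSum_iff fun p hp => by
    rw [integral_fourierTerm, if_neg fun h => hp ⟨p.1, Prod.ext rfl h⟩, Complex.ofReal_zero,
      mul_zero]).2 (hasSum_integral_fourierTerm x j k)
  rw [intervalIntegral.integral_div, ← hsum.tsum_eq, Complex.ofReal_tsum, ← tsum_div_const]
  refine tsum_congr fun m => ?_
  have hpi : (Real.pi : ℂ) ≠ 0 := by exact_mod_cast Real.pi_ne_zero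
  simp only [Function.comp_apply, integral_fourierTerm, if_true]
  push_cast
  field_simp

theorem toeplitz_eq_map_armGram (lam : ℝ) (n : ℕ) :
    toeplitz lam n = (armGram √lam 0 n).map Complex.ofReal := by
  ext j k
  simpa [toeplitz, armGram, armCoeff_zero_arm] using integral_exp_mul_exp_cos √lam j k

theorem det_toeplitz (lam : ℝ) (n : ℕ) : (toeplitz lam n).det = ((armGram √lam 0 n).det : ℂ) := by
  rw [toeplitz_eq_map_armGram]
  exact (RingHom.map_det Complex.ofRealHom _).symm

theorem isUnit_det_toeplitz (lam : ℝ) (n : ℕ) : IsUnit (toeplitz lam n).det := by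
  rw [det_toeplitz, isUnit_iff_ne_zero]
  exact_mod_cast (det_armGram_zero_pos √lam n).ne'

end Toeplitz

section BeadConfigurations

variable {μ ν : YoungDiagram} {L s : ℕ}

theorem eq_of_profile_eq (hμ : μ.rowLen 1 ≤ L) (hν : ν.rowLen 1 ≤ L)
    (harm : μ.rowLen 0 - L = ν.rowLen 0 - L) (hprofile : profile L μ = profile L ν) : μ = ν := by
  refine youngDiagram_ext_colLen fun p => ?_
  rcases lt_or_ge p L with hp | hp
  · simpa [profile] using congrFun hprofile (Fin.rev ⟨p, hp⟩)
  · rw [colLen_eq_ite hμ hp, colLen_eq_ite hν hp]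
    exact if_congr (by omega) rfl rfl

theorem exists_forall_colLen_eq {c : ℕ → ℕ} (hc : Antitone c) {K : ℕ} (hK : c K = 0) :
    ∃ μ : YoungDiagram, ∀ p, μ.colLen p = c p := by
  let cells : Finset (ℕ × ℕ) := {q ∈ Finset.range (c 0) ×ˢ Finset.range K | q.1 < c q.2}
  have mem_cells (q : ℕ × ℕ) : q ∈ cells ↔ q.1 < c q.2 := by
    simp only [cells, Finset.mem_filter, Finset.mem_product, Finset.mem_range,
      and_iff_right_iff_imp]
    refine fun hq => ⟨hq.trans_le (hc (Nat.zero_le _)), not_le.1 fun hle => ?_⟩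
    have := hc hle
    omega
  have isLowerSet_cells : IsLowerSet (cells : Set (ℕ × ℕ)) := fun q r hrq hq => by
    rw [Finset.mem_coe, mem_cells] at hq ⊢
    exact (hrq.1.trans_lt hq).trans_le (hc hrq.2)
  refine ⟨⟨cells, isLowerSet_cells⟩, fun p => eq_of_forall_lt_iff fun i => ?_⟩
  rw [← YoungDiagram.mem_iff_lt_colLen]
  exact mem_cells (i, p)

theorem val_le_of_strictMono {h : Fin L → ℕ} (hh : StrictMono h) (i : Fin L) : i ≤ h i := by
  simpa using Finset.card_le_card_of_injOn (s := Finset.Iio i) (t := Finset.range (h i)) h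
    (fun k hk => by simpa using hh (Finset.mem_Iio.1 hk)) hh.injective.injOn

/-- The column lengths of the diagram with bead positions `h` and arm `s`, inverse to
`μ ↦ (μ.rowLen 0 - L, profile L μ)`. -/
def beadColLen (s : ℕ) (h : Fin L → ℕ) (p : ℕ) : ℕ :=
  if hp : p < L then h (Fin.rev ⟨p, hp⟩) - (Fin.rev ⟨p, hp⟩ : Fin L) else if p < L + s then 1 else 0

theorem antitone_beadColLen {h : Fin L → ℕ} (hh : StrictMono h) (hs : s ≠ 0 → ∀ i, h i ≠ 0) :
    Antitone (beadColLen s h) := by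
  refine antitone_nat_of_succ_le fun p => ?_
  unfold beadColLen
  rcases lt_trichotomy (p + 1) L with hp | hp | hp
  · have hlt : h (Fin.rev ⟨p + 1, hp⟩) < h (Fin.rev ⟨p, by omega⟩) :=
      hh (Fin.rev_lt_rev.2 (Fin.mk_lt_mk.2 p.lt_succ_self))
    rw [dif_pos hp, dif_pos (by omega)]
    simp only [Fin.val_rev]
    omega
  · rw [dif_neg hp.not_lt, dif_pos (by omega)]
    split_ifs with hps
    · have := hs (by omega) (Fin.rev ⟨p, by omega⟩)
      simp only [Fin.val_rev]
      omega
    · exact Nat.zero_le _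
  · rw [dif_neg (by omega), dif_neg (by omega)]
    split_ifs <;> omega

theorem exists_profile_eq {h : Fin L → ℕ} (hh : StrictMono h) (hs : s ≠ 0 → ∀ i, h i ≠ 0) :
    ∃ μ : YoungDiagram, μ.rowLen 1 ≤ L ∧ μ.rowLen 0 - L = s ∧ profile L μ = h := by
  obtain ⟨μ, hμ⟩ := exists_forall_colLen_eq (antitone_beadColLen hh hs) (K := L + s)
    (by simp [beadColLen])
  have lt_rowLen (i q : ℕ) : L + q < μ.rowLen i ↔ i < if q < s then 1 else 0 := by
    rw [← lt_colLen_iff_lt_rowLen, hμ, beadColLen, dif_neg (by omega)]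
    simp only [Nat.add_lt_add_iff_left]
  refine ⟨μ, ?_, eq_of_forall_lt_iff fun q => ?_, funext fun i => ?_⟩
  · have := lt_rowLen 1 0
    split_ifs at this <;> omega
  · rw [lt_tsub_iff_left, lt_rowLen]
    split_ifs <;> omega
  · rw [profile, hμ, beadColLen, dif_pos i.rev.isLt, Fin.eta, Fin.rev_rev]
    exact Nat.sub_add_cancel (val_le_of_strictMono hh i)

end BeadConfigurations

section PoissonizedSums

variable {L : ℕ}

theorem hasSum_phiTerm {k n : ℕ} {x S : ℝ}
    (hS : HasSum (fun μ : {μ : YoungDiagram // μ.rowLen (k - 1) ≤ n} => amplitude x μ ^ 2) S) :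
    HasSum (phiTerm k n (x ^ 2)) (Real.exp (-x ^ 2) * S) := by
  have hindicator : HasSum ({μ : YoungDiagram | μ.rowLen (k - 1) ≤ n}.indicator
      fun μ => amplitude x μ ^ 2) S := hasSum_subtype_iff_indicator.1 hS
  refine ((hindicator.tsum_fiberwise YoungDiagram.card).mul_left (Real.exp (-x ^ 2))).congr_fun
    fun N => ?_
  have hfiber : YoungDiagram.card ⁻¹' {N} = (youngDiagrams N : Set YoungDiagram) := by
    ext μ
    simp [youngDiagrams]
  rw [hfiber, Finset.tsum_subtype' (youngDiagrams N), phiTerm, q, Finset.mul_sum,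
    Finset.sum_filter, Finset.mul_sum]
  refine Finset.sum_congr rfl fun μ hμ => ?_
  have hN : μ.card = N := by simpa [youngDiagrams] using hμ
  simp only [Set.indicator_apply, Set.mem_ofPred_eq, mul_ite, mul_zero, amplitude, hN]
  refine if_congr Iff.rfl ?_ rfl
  field_simp
  ring

theorem amplitude_sq (x : ℝ) {μ : YoungDiagram} (hμ : μ.rowLen 1 ≤ L) :
    amplitude x μ ^ 2 = (x ^ 2) ^ (μ.rowLen 0 - L) / ((μ.rowLen 0 - L)! : ℝ) ^ 2 *
      (armMatrix x (μ.rowLen 0 - L) (profile L μ)).det ^ 2 := by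
  rw [amplitude_eq_armDet x hμ, armDet, mul_pow, div_pow, pow_right_comm]

theorem hasSum_amplitude_sq_of_rowLen_zero_le (x : ℝ) (L : ℕ) :
    HasSum (fun μ : {μ : YoungDiagram // μ.rowLen 0 ≤ L} => amplitude x μ ^ 2)
      (armGram x 0 L).det := by
  have rowLen_one_le (μ : {μ : YoungDiagram // μ.rowLen 0 ≤ L}) : μ.1.rowLen 1 ≤ L :=
    (μ.1.rowLen_anti 0 1 zero_le_one).trans μ.2
  have arm_eq_zero (μ : {μ : YoungDiagram // μ.rowLen 0 ≤ L}) : μ.1.rowLen 0 - L = 0 :=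
    Nat.sub_eq_zero_of_le μ.2
  have profile_injective : Function.Injective
      fun μ : {μ : YoungDiagram // μ.rowLen 0 ≤ L} => profile L μ := fun μ ν h =>
    Subtype.ext <| eq_of_profile_eq (rowLen_one_le μ) (rowLen_one_le ν)
      ((arm_eq_zero μ).trans (arm_eq_zero ν).symm) h
  refine ((profile_injective.hasSum_iff fun h hh => if_neg fun hmono => hh ?_).2
    (hasSum_det_armMatrix_sq x 0 L)).congr_fun fun μ => ?_
  · obtain ⟨μ, -, harm, rfl⟩ := exists_profile_eq (s := 0) hmono (absurd rfl)
    exact ⟨⟨μ, Nat.sub_eq_zero_iff_le.1 harm⟩, rfl⟩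
  · simp [amplitude_sq x (rowLen_one_le μ), arm_eq_zero, profile_strictMono]

theorem hasSum_arm_mul_det_armMatrix_sq (x : ℝ) (L : ℕ) :
    HasSum (fun p : ℕ × (Fin L → ℕ) => (x ^ 2) ^ p.1 / (p.1 ! : ℝ) ^ 2 *
        if StrictMono p.2 then (armMatrix x p.1 p.2).det ^ 2 else 0)
      (∑' s : ℕ, (x ^ 2) ^ s / (s ! : ℝ) ^ 2 * (armGram x s L).det) := by
  have hfiber (s : ℕ) := (hasSum_det_armMatrix_sq x s L).mul_left ((x ^ 2) ^ s / (s ! : ℝ) ^ 2)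
  have hsummable := (summable_prod_of_nonneg (f := fun p : ℕ × (Fin L → ℕ) =>
      (x ^ 2) ^ p.1 / (p.1 ! : ℝ) ^ 2 * if StrictMono p.2 then (armMatrix x p.1 p.2).det ^ 2 else 0)
    fun p => mul_nonneg (by positivity) (by split_ifs <;> positivity)).2
    ⟨fun s => (hfiber s).summable,
      by simpa only [(hfiber _).tsum_eq] using summable_det_armGram x L⟩
  rw [(hsummable.hasSum.prod_fiberwise hfiber).tsum_eq]
  exact hsummable.hasSum

theorem hasSum_amplitude_sq_of_rowLen_one_le (x : ℝ) (L : ℕ) :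
    HasSum (fun μ : {μ : YoungDiagram // μ.rowLen 1 ≤ L} => amplitude x μ ^ 2)
      (∑' s : ℕ, (x ^ 2) ^ s / (s ! : ℝ) ^ 2 * (armGram x s L).det) := by
  have arm_profile_injective : Function.Injective
      fun μ : {μ : YoungDiagram // μ.rowLen 1 ≤ L} => (μ.1.rowLen 0 - L, profile L μ) :=
    fun μ ν h => Subtype.ext <|
      eq_of_profile_eq μ.2 ν.2 (congrArg Prod.fst h) (congrArg Prod.snd h)
  refine ((arm_profile_injective.hasSum_iff fun p hp => ?_).2
    (hasSum_arm_mul_det_armMatrix_sq x L)).congr_fun fun μ => ?_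
  · refine mul_eq_zero_of_right _ (ite_eq_right_iff.2 fun hmono => ?_)
    by_cases hs : p.1 ≠ 0 → ∀ i, p.2 i ≠ 0
    · obtain ⟨μ, hμ, harm, hprofile⟩ := exists_profile_eq hmono hs
      exact absurd ⟨⟨μ, hμ⟩, Prod.ext harm hprofile⟩ hp
    · push Not at hs
      obtain ⟨hs, i, hi⟩ := hs
      rw [det_armMatrix_eq_zero hs hi, zero_pow two_ne_zero]
  · simp only [Function.comp_apply, if_pos (profile_strictMono L μ.1), amplitude_sq x μ.2]

end PoissonizedSums

section Conclusion

open Matrix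

theorem hasSum_phiTerm_one {lam : ℝ} (hlam : 0 ≤ lam) (n : ℕ) :
    HasSum (phiTerm 1 n lam) (Real.exp (-lam) * (armGram √lam 0 n).det) := by
  simpa only [Real.sq_sqrt hlam] using
    hasSum_phiTerm (k := 1) (hasSum_amplitude_sq_of_rowLen_zero_le √lam n)

theorem hasSum_phiTerm_two {lam : ℝ} (hlam : 0 ≤ lam) (n : ℕ) :
    HasSum (phiTerm 2 n lam)
      (Real.exp (-lam) * ∑' s : ℕ, lam ^ s / (s ! : ℝ) ^ 2 * (armGram √lam s n).det) := by
  simpa only [Real.sq_sqrt hlam] using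
    hasSum_phiTerm (k := 2) (hasSum_amplitude_sq_of_rowLen_one_le √lam n)

theorem det_armGram_succ {lam : ℝ} (hlam : 0 ≤ lam) (n s : ℕ) :
    ((armGram √lam s (n + 1)).det : ℂ) = (armGram √lam 0 n).det *
      (aZero lam s - ((toeplitz lam n)⁻¹ *ᵥ b lam n s) ⬝ᵥ star (b lam n s)) := by
  have hblock : ((armGram √lam s (n + 1)).map Complex.ofReal).submatrix Fin.succ Fin.succ =
      toeplitz lam n := by
    rw [toeplitz_eq_map_armGram, ← armGram_submatrix_succ √lam s n]
    rfl
  have hrow (j : Fin n) : armGram √lam s (n + 1) 0 j.succ = a lam (j + 1) s := by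
    rw [armGram_zero_succ (Real.sqrt_nonneg lam), Real.sq_sqrt hlam]
  have hb : (fun j : Fin n => (armGram √lam s (n + 1) 0 j.succ : ℂ)) = b lam n s :=
    funext fun j => congrArg Complex.ofReal (hrow j)
  have hstar : star (b lam n s) = b lam n s := funext fun j => Complex.conj_ofReal _
  have hschur := det_eq_det_mul_schurComplement _ hblock (isUnit_det_toeplitz lam n)
  simp only [map_apply, armGram_comm _ _ (Fin.succ _) 0, hb, armGram_zero_zero, Real.sq_sqrt hlam,
    det_toeplitz] at hschur
  rw [hstar, ← hschur]
  exact RingHom.map_det Complex.ofRealHom _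

theorem phi_one_pos {lam : ℝ} (hlam : 0 ≤ lam) (n : ℕ) : 0 < phi 1 n lam := by
  rw [phi, (hasSum_phiTerm_one hlam n).tsum_eq]
  exact mul_pos (Real.exp_pos _) (det_armGram_zero_pos _ n)

theorem hasSum_bracketTerm {lam : ℝ} (hlam : 0 ≤ lam) (n : ℕ) :
    HasSum (bracketTerm lam n) ((phi 2 (n + 1) lam / phi 1 n lam : ℝ) : ℂ) := by
  have hsummable := summable_det_armGram √lam (n + 1)
  rw [Real.sq_sqrt hlam] at hsummable
  have hsum := Complex.hasSum_ofReal.2 (hsummable.hasSum.div_const (armGram √lam 0 n).det)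
  rw [phi, phi, (hasSum_phiTerm_one hlam n).tsum_eq, (hasSum_phiTerm_two hlam (n + 1)).tsum_eq,
    mul_div_mul_left _ _ (Real.exp_pos _).ne']
  refine hsum.congr_fun fun s => ?_
  have hdet := Complex.ofReal_ne_zero.2 (det_armGram_zero_pos √lam n).ne'
  rw [bracketTerm, Complex.ofReal_div, Complex.ofReal_mul, det_armGram_succ hlam,
    mul_div_assoc, mul_div_cancel_left₀ _ hdet]
  push_cast
  rfl

theorem bracketTerm_zero (lam : ℝ) (s : ℕ) :
    bracketTerm lam 0 s = ((lam ^ s / (s ! : ℝ) ^ 2 * aZero lam s : ℝ) : ℂ) := by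
  simp [bracketTerm]

end Conclusion

end PlancherelSecondRow

open PlancherelSecondRow in
open scoped Nat in
theorem proposition3p1 (lam : ℝ) (hlam : 0 ≤ lam) :
    (∀ n : ℕ, Summable (phiTerm 1 n lam) ∧ Summable (phiTerm 2 (n + 1) lam)) ∧
    (∀ n : ℕ, 1 ≤ n →
      IsUnit (toeplitz lam n).det ∧
      Summable (fun s : ℕ => bracketTerm lam n s) ∧
      (phi 2 (n + 1) lam : ℂ) = (∑' s : ℕ, bracketTerm lam n s) * (phi 1 n lam : ℂ)) ∧
    (Summable (fun s : ℕ => lam ^ s / (s ! : ℝ) ^ 2 * aZero lam s) ∧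
      phi 2 1 lam = (∑' s : ℕ, lam ^ s / (s ! : ℝ) ^ 2 * aZero lam s) * phi 1 0 lam) := by
  have hne (n : ℕ) : phi 1 n lam ≠ 0 := (phi_one_pos hlam n).ne'
  have hsum_zero : HasSum (fun s : ℕ => lam ^ s / (s ! : ℝ) ^ 2 * aZero lam s)
      (phi 2 1 lam / phi 1 0 lam) := by
    have hbracket := hasSum_bracketTerm hlam 0
    simp only [funext (bracketTerm_zero lam)] at hbracket
    exact Complex.hasSum_ofReal.1 hbracket
  refine ⟨fun n => ⟨(hasSum_phiTerm_one hlam n).summable,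
      (hasSum_phiTerm_two hlam (n + 1)).summable⟩,
    fun n _ => ⟨isUnit_det_toeplitz lam n, (hasSum_bracketTerm hlam n).summable, ?_⟩,
    hsum_zero.summable, ?_⟩
  · rw [(hasSum_bracketTerm hlam n).tsum_eq, ← Complex.ofReal_mul, div_mul_cancel₀ _ (hne n)]
  · rw [hsum_zero.tsum_eq, div_mul_cancel₀ _ (hne 0)]
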